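/- Fix an integer $\ell\ge 2$ and $0\le i\le \ell$. Consider the array with $2\ell$ rows, numbered $1,\dots,2\ell$ from the top, in which every odd-numbered row contains the parts $1,3,5,\dots$ and every even-numbered row contains the parts $2,4,6,\dots$; place the part $v$ of row $r$ at the horizontal position $v$. Equal values in different rows are distinct parts (of different colors). A *colored partition* of $n$ is a multiset of finitely many parts of the array with sum $n$ (the empty multiset being the only one for $n=0$); its *frequency array* assigns to the cell of each part the number of times this part occurs. The frequency array is extended to the left by one further column, consisting of the position $-1$ in each odd row and the position $0$ in each even row. Given nonnegative integers $k_0,\dots,k_\ell$, write into this column the entry $k_0$ in row $2\ell$, the entry $k_m$ in row $m$ if $1\le m\le \ell$ is odd, the entry $k_m$ in row $2\ell+1-m$ if $2\le m\le\ell$ is even, and the entry $0$ in all remaining cells. A *downward path* consists of one cell of the extended array in each of the rows $1,\dots,2\ell$, such that the positions of its cells in consecutive rows differ by exactly $1$. A colored partition is *$[k_0,\dots,k_\ell]$-admissible* if, for every downward path, the sum of the entries of the extended frequency array along the path is at most $k_0+k_1+\cdots+k_\ell$. Let $F(i,j,n)$ be the number of colored partitions of $n$ with exactly $j$ parts (counted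 with multiplicity) that are $[k_0,\dots,k_\ell]$-admissible for $k_i=1$ and $k_m=0$ for all $m\ne i$, and put $$P_i(z,q)=\sum_{n,j\ge 0}F(i,j,n)\,z^jq^n .$$ Then, as an identity of formal power series in $z$ and $q$ with integer coefficients, $$P_i(z,q)=\sum_{n_1,n_2,\dots,n_\ell\ge 0}\frac{z^{n_1+n_2+\cdots+n_\ell}\,q^{N_1^2+N_2^2+\cdots+N_\ell^2+N_{i+1}+N_{i+2}+\cdots+N_\ell}}{(q;q)_{n_1}(q;q)_{n_2}\cdots(q;q)_{n_\ell}},$$ where $N_s=n_s+n_{s+1}+\cdots+n_\ell$, $(q;q)_n=\prod_{j=1}^n(1-q^j)$, and the multisum converges in the sense that each coefficient receives only finitely many nonzero contributions. -/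

import Mathlib

open PowerSeries
open scoped PowerSeries.WithPiTopology

namespace CMPP

/-! ### The array with `2ℓ` rows

A cell of the array is given by its row `r ∈ {1, …, 2ℓ}` (counted from the top) and its horizontal
position.  Odd rows contain the parts `1, 3, 5, …`, even rows contain the parts `2, 4, 6, …`, and
the part `v` stands at horizontal position `v`.  In the frequency array there is one more column on
the left, which carries the initial conditions: position `-1` in odd rows, `0` in even rows. -/

/-- The cell `(r, v)` (row `r`, value `v`) is a part of the array with `2ℓ` rows. -/
def IsPart (ℓ : ℕ) (c : ℕ × ℕ) : Prop :=
  1 ≤ c.1 ∧ c.1 ≤ 2 * ℓ ∧ 1 ≤ c.2 ∧ c.2 ≡ c.1 [MOD 2]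

/-- A colored partition: a finitely supported array of frequencies `f`, where `f (r, v)` is the
number of times that the part `v` of row `r` occurs. -/
def IsColoredPartition (ℓ : ℕ) (f : ℕ × ℕ →₀ ℕ) : Prop :=
  ∀ c ∈ f.support, IsPart ℓ c

/-- The number of parts, counted with multiplicity. -/
def numParts (f : ℕ × ℕ →₀ ℕ) : ℕ := f.sum fun _ m => m

/-- The sum of all parts, counted with multiplicity. -/
def size (f : ℕ × ℕ →₀ ℕ) : ℕ := f.sum fun c m => m * c.2

/-- The row in which the initial condition `k_i` (`0 ≤ i ≤ ℓ`) stands. -/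
def initialRow (ℓ i : ℕ) : ℕ :=
  if i = 0 then 2 * ℓ else if Odd i then i else 2 * ℓ + 1 - i

/-- The horizontal position of the initial condition `k_i`. -/
def initialPos (i : ℕ) : ℤ := if i = 0 then 0 else -1

/-- The entry of the left column of the frequency array at row `r` and position `x ∈ {-1, 0}`:
it is `k_i` in the cell of `k_i`, and `0` in the remaining cells. -/
def initialEntry (ℓ : ℕ) (k : Fin (ℓ + 1) → ℕ) (r : ℕ) (x : ℤ) : ℕ :=
  ∑ i : Fin (ℓ + 1), if r = initialRow ℓ i ∧ x = initialPos i then k i else 0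

/-- The entry of the frequency array at row `r` and position `x`. -/
def entry (ℓ : ℕ) (k : Fin (ℓ + 1) → ℕ) (f : ℕ × ℕ →₀ ℕ) (r : ℕ) (x : ℤ) : ℕ :=
  if x ≤ 0 then initialEntry ℓ k r x else f (r, x.toNat)

/-- A downward path goes from the top row to the bottom row of the frequency array; `p r` is
its position in row `r`, and each step leads to one of the two cells of the next row that are
adjacent to the current one (left or right below it). -/
structure IsDownwardPath (ℓ : ℕ) (p : ℕ → ℤ) : Prop where
  mem_array : ∀ r, 1 ≤ r → r ≤ 2 * ℓ → -1 ≤ p r ∧ p r ≡ r [ZMOD 2]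
  step : ∀ r, 1 ≤ r → r < 2 * ℓ → p (r + 1) = p r + 1 ∨ p (r + 1) = p r - 1

/-- `[k_0, …, k_ℓ]`-admissibility of an array of frequencies. -/
def IsAdmissible (ℓ : ℕ) (k : Fin (ℓ + 1) → ℕ) (f : ℕ × ℕ →₀ ℕ) : Prop :=
  ∀ p : ℕ → ℤ, IsDownwardPath ℓ p →
    ∑ r ∈ Finset.Icc 1 (2 * ℓ), entry ℓ k f r (p r) ≤ ∑ i, k i

/-- The set of `[k_0, …, k_ℓ]`-admissible colored partitions of `n` with exactly `j` parts. -/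
def admissiblePartitions (ℓ : ℕ) (k : Fin (ℓ + 1) → ℕ) (j n : ℕ) : Set (ℕ × ℕ →₀ ℕ) :=
  {f | IsColoredPartition ℓ f ∧ IsAdmissible ℓ k f ∧ numParts f = j ∧ size f = n}

/-- The set just defined is finite, so that its `Set.ncard` is its number of elements. -/
theorem admissiblePartitions_finite (ℓ : ℕ) (k : Fin (ℓ + 1) → ℕ) (j n : ℕ) :
    (admissiblePartitions ℓ k j n).Finite := by
  let g : ℕ × ℕ →₀ ℕ :=
    Finsupp.indicator (Finset.range (2 * ℓ + 1) ×ˢ Finset.range (n + 1)) fun _ _ => n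
  refine (Finset.Iic g).finite_toSet.subset ?_
  rintro f ⟨hf, -, -, hn⟩
  simp only [Finset.coe_Iic, Set.mem_Iic]
  intro c
  by_cases hc : c ∈ f.support
  · obtain ⟨h1, h2, h3, -⟩ := hf c hc
    have hle : f c * c.2 ≤ n := by
      rw [← hn]
      exact Finset.single_le_sum (f := fun c => f c * c.2) (fun _ _ => Nat.zero_le _) hc
    have hpos : 1 ≤ f c := Nat.one_le_iff_ne_zero.mpr (Finsupp.mem_support_iff.mp hc)
    have hmem : c ∈ Finset.range (2 * ℓ + 1) ×ˢ Finset.range (n + 1) := by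
      simp only [Finset.mem_product, Finset.mem_range]
      constructor
      · omega
      · nlinarith
    rw [Finsupp.indicator_of_mem hmem]
    nlinarith
  · simp [Finsupp.notMem_support_iff.mp hc]

/-- The initial conditions with `k_i = 1` and all other `k_j = 0`. -/
def unitInitial (ℓ : ℕ) (i : Fin (ℓ + 1)) : Fin (ℓ + 1) → ℕ := Pi.single i 1

/-- `F(i, j, n)`: the number of admissible colored partitions of `n` with exactly `j` parts, for
the initial conditions `k_i = 1` and all other `k_j = 0`. -/
noncomputable def F (ℓ : ℕ) (i : Fin (ℓ + 1)) (j n : ℕ) : ℕ :=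
  (admissiblePartitions ℓ (unitInitial ℓ i) j n).ncard

/-- `P_i(z, q) = ∑_{n, j ≥ 0} F(i, j, n) z^j q^n`, as an element of `ℤ⟦q⟧⟦z⟧`: the outer variable
is `z`, the inner one is `q`. -/
noncomputable def P (ℓ : ℕ) (i : Fin (ℓ + 1)) : ℤ⟦X⟧⟦X⟧ :=
  PowerSeries.mk fun j => PowerSeries.mk fun n => (F ℓ i j n : ℤ)

/-! ### The multisum -/

/-- The finite `q`-Pochhammer symbol `(a; q)_n = ∏_{j=1}^n (1 - a q^{j-1})` in `ℤ⟦q⟧`. -/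
noncomputable def qPochhammer (a : ℤ⟦X⟧) (n : ℕ) : ℤ⟦X⟧ :=
  ∏ j ∈ Finset.Icc 1 n, (1 - a * X ^ (j - 1))

/-- `1 / (q; q)_n` in `ℤ⟦q⟧` -/
noncomputable def invQPochhammer (n : ℕ) : ℤ⟦X⟧ :=
  PowerSeries.invOfUnit (qPochhammer X n) 1

/-- `invQPochhammer n` is indeed the inverse of `(q; q)_n`. -/
theorem qPochhammer_mul_inv (n : ℕ) : qPochhammer X n * invQPochhammer n = 1 := by
  apply PowerSeries.mul_invOfUnit
  simp [qPochhammer, map_prod]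

/-- `N_s = n_s + n_{s+1} + ⋯ + n_ℓ`.  The index set `{1, …, ℓ}` is represented by `Fin ℓ`, with
`s : Fin ℓ` standing for the index `s + 1`. -/
def tailSum {ℓ : ℕ} (n : Fin ℓ → ℕ) (s : Fin ℓ) : ℕ := ∑ t ∈ Finset.Ici s, n t

/-- The exponent `N_1² + ⋯ + N_ℓ² + N_{i+1} + ⋯ + N_ℓ` of `q`. -/
def qExponent {ℓ : ℕ} (i : Fin (ℓ + 1)) (n : Fin ℓ → ℕ) : ℕ :=
  ∑ s : Fin ℓ, tailSum n s ^ 2 +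
    ∑ s ∈ Finset.univ.filter (fun s : Fin ℓ => (i : ℕ) + 1 ≤ (s : ℕ) + 1), tailSum n s

/-- The summand
`z^{n_1 + ⋯ + n_ℓ} q^{N_1² + ⋯ + N_ℓ² + N_{i+1} + ⋯ + N_ℓ} / ((q; q)_{n_1} ⋯ (q; q)_{n_ℓ})`. -/
noncomputable def multisumTerm {ℓ : ℕ} (i : Fin (ℓ + 1)) (n : Fin ℓ → ℕ) : ℤ⟦X⟧⟦X⟧ :=
  X ^ (∑ s, n s) * PowerSeries.C (X ^ qExponent i n * ∏ s, invQPochhammer (n s))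

end CMPP

/-!
If the initial conditions sum to `1`, then admissibility says that every downward path meets at
most one part, the initial cell included.  Two cells lie on a common downward path exactly if their
positions differ by at most as much as their rows (`exists_isDownwardPath_through`,
`IsDownwardPath.abs_sub_le`).  Hence the admissible partitions are the sets of cells that are
pairwise separated, in the sense that positions differ by more than rows, and that are separated
from the initial cell as well (`admissiblePartitions_eq_image`).

The separated sets in the cone to the right of an apex satisfy a linear recurrence.  The cone of
the apex `(r, x)` is the union of the cones of `(r + 1, x + 1)` and `(r - 1, x + 1)` together with
its tip `(r, x + 2)`, the intersection of these two cones is the cone of `(r, x + 2)`, and a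
separated set that avoids the tip lies in one of the two cones.  Inclusion-exclusion gives
`configSeries_recurrence`.  At the border of the array the recurrence remains true, since the cone
of an apex in row `0` or `2ℓ + 1` is the cone of its neighbor within the array.

The coefficients `s_i(m)` of `z ^ m` in the multisums satisfy `s_0(m) = q ^ m s_1(m)` and, for
`1 ≤ i ≤ ℓ` and `m ≥ 1`,
`(1 + q ^ (2m)) s_i(m) = q ^ m (s_{i-1}(m) + s_{i+1}(m)) + q ^ (2m-1) s_i(m-1)`,
where `s_{ℓ+1} = s_ℓ`; this follows by induction on `ℓ`, from a recursion that removes the outermost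
summation variable (`multisumCoeff_recurrence`).  These are the relations of the cones, if the rows
`i` and `2ℓ + 1 - i` are both assigned the index `i`, and the relations have only one solution
(`configSeries_eq`).
-/

namespace CMPP

open Finset.HasAntidiagonal

/-! ### The coefficients of the multisum and their recurrence -/

theorem invQPochhammer_zero : invQPochhammer 0 = 1 := by
  simpa [qPochhammer] using qPochhammer_mul_inv 0

theorem one_sub_X_pow_mul_invQPochhammer_succ (a : ℕ) :
    (1 - X ^ (a + 1)) * invQPochhammer (a + 1) = invQPochhammer a := by
  have h₀ := qPochhammer_mul_inv a
  have h₁ := qPochhammer_mul_inv (a + 1)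
  have h : qPochhammer X (a + 1) = qPochhammer X a * (1 - X ^ (a + 1)) := by
    rw [qPochhammer, Finset.prod_Icc_succ_top (by omega), Nat.add_sub_cancel, ← pow_succ']
    rfl
  rw [h] at h₁
  linear_combination (-(1 - X ^ (a + 1)) * invQPochhammer (a + 1)) * h₀ + invQPochhammer a * h₁

/-- The coefficient of `z ^ m` in the multisum with `ℓ` summation variables, computed by peeling off
the outermost variable: if `N_1 = m`, then `N_2, …, N_ℓ` run through the summation indices of a
multisum with one variable less, whose total is `N_2` and whose index `i` has dropped by one (the
index `0` stays, and contributes the linear term `N_1` to the exponent).  The index is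
not bounded by `ℓ`; all indices `i ≥ ℓ` give the same series. -/
noncomputable def multisumCoeff : ℕ → ℕ → ℕ → ℤ⟦X⟧
  | 0, _, m => if m = 0 then 1 else 0
  | ℓ + 1, i, m => X ^ (m ^ 2 + if i = 0 then m else 0) *
      ∑ p ∈ antidiagonal m, invQPochhammer p.1 * multisumCoeff ℓ (i - 1) p.2

theorem multisumCoeff_zero_right (ℓ i : ℕ) : multisumCoeff ℓ i 0 = 1 := by
  induction ℓ generalizing i with
  | zero => simp [multisumCoeff]
  | succ ℓ ih => simp [multisumCoeff, ih, invQPochhammer_zero]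

theorem multisumCoeff_zero_index (ℓ m : ℕ) :
    multisumCoeff ℓ 0 m = X ^ m * multisumCoeff ℓ 1 m := by
  cases ℓ with
  | zero => by_cases h : m = 0 <;> simp [multisumCoeff, h]
  | succ ℓ => simp [multisumCoeff, pow_add]; ring

theorem multisumCoeff_index_self (ℓ : ℕ) (m : ℕ) :
    multisumCoeff ℓ (ℓ + 1) m = multisumCoeff ℓ ℓ m := by
  induction ℓ generalizing m with
  | zero => simp [multisumCoeff]
  | succ ℓ ih =>
    simp [multisumCoeff, ih]

/-- Reindexing by `1 / (q; q)_a = (1 - q ^ (a + 1)) / (q; q)_{a + 1}`; the extra term on the right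
has the factor `1 - q ^ 0 = 0`. -/
theorem sum_antidiagonal_invQPochhammer_mul (g : ℕ → ℕ → ℤ⟦X⟧) (m : ℕ) :
    ∑ p ∈ antidiagonal m, invQPochhammer p.1 * g (p.1 + 1) p.2 =
      ∑ p ∈ antidiagonal (m + 1), (1 - X ^ p.1) * invQPochhammer p.1 * g p.1 p.2 := by
  rw [Finset.Nat.sum_antidiagonal_succ]
  simp [one_sub_X_pow_mul_invQPochhammer_succ]

/-- The linear relation between three neighboring multisums, obtained by induction on `ℓ`: the
relation for `ℓ` multiplied by `1 / (q; q)_{m - n}` and summed over `n` gives the one for `ℓ + 1`.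
The multisum with index `0` enters through `multisumCoeff_zero_index`. -/
theorem multisumCoeff_recurrence {ℓ i : ℕ} (hi : i < ℓ) (m : ℕ) :
    (1 + X ^ (2 * (m + 1))) * multisumCoeff ℓ (i + 1) (m + 1) =
      X ^ (m + 1) * (multisumCoeff ℓ i (m + 1) + multisumCoeff ℓ (i + 2) (m + 1)) +
        X ^ (2 * m + 1) * multisumCoeff ℓ (i + 1) m := by
  induction ℓ generalizing i m with
  | zero => omega
  | succ ℓ ih =>
    -- The shift from `m` to `m + 1` is absorbed by `(m + 1) ^ 2 = m ^ 2 + 2 * m + 1`.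
    have e : X ^ (2 * m + 1) * multisumCoeff (ℓ + 1) (i + 1) m = X ^ ((m + 1) ^ 2) *
        ∑ p ∈ antidiagonal (m + 1),
          (1 - X ^ p.1) * invQPochhammer p.1 * multisumCoeff ℓ i p.2 := by
      rw [← sum_antidiagonal_invQPochhammer_mul (fun _ n => multisumCoeff ℓ i n)]
      simp only [multisumCoeff, Nat.add_one_ne_zero, if_false, add_zero, Nat.add_sub_cancel]
      ring
    rw [e]
    rcases Nat.eq_zero_or_pos i with rfl | hpos
    · rw [multisumCoeff_zero_index]
      simp only [multisumCoeff, Nat.add_one_ne_zero, if_false, add_zero, zero_add, Nat.sub_self,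
        OfNat.ofNat_ne_zero, Nat.reduceSub]
      have key : ∑ p ∈ antidiagonal (m + 1), invQPochhammer p.1 * multisumCoeff ℓ 0 p.2 =
          X ^ (m + 1) * ∑ p ∈ antidiagonal (m + 1),
            invQPochhammer p.1 * multisumCoeff ℓ 1 p.2 +
          ∑ p ∈ antidiagonal (m + 1),
            (1 - X ^ p.1) * invQPochhammer p.1 * multisumCoeff ℓ 0 p.2 := by
        rw [Finset.mul_sum, ← Finset.sum_add_distrib]
        refine Finset.sum_congr rfl fun p hp => ?_
        rw [← mem_antidiagonal.mp hp, multisumCoeff_zero_index]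
        ring
      linear_combination X ^ ((m + 1) ^ 2) * key
    · obtain ⟨j, rfl⟩ : ∃ j, i = j + 1 := ⟨i - 1, by omega⟩
      simp only [multisumCoeff, Nat.add_one_ne_zero, if_false, add_zero, Nat.add_sub_cancel,
        show j + 1 + 2 - 1 = j + 2 by omega]
      -- The inductive hypothesis at `p.2`, multiplied by `q ^ p.1`, where `p.1 + p.2 = m + 1`; at
      -- `p.2 = 0` both sides vanish.
      have low : ∑ p ∈ antidiagonal (m + 1), invQPochhammer p.1 *
            (X ^ p.1 * ((1 + X ^ (2 * p.2)) * multisumCoeff ℓ (j + 1) p.2) -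
              X ^ (m + 1) * (multisumCoeff ℓ j p.2 + multisumCoeff ℓ (j + 2) p.2)) =
          ∑ p ∈ antidiagonal (m + 1), (1 - X ^ p.1) * invQPochhammer p.1 *
            (X ^ (p.1 + 2 * p.2) * multisumCoeff ℓ (j + 1) p.2) := by
        rw [← sum_antidiagonal_invQPochhammer_mul
          (fun a n => X ^ (a + 2 * n) * multisumCoeff ℓ (j + 1) n),
          Finset.Nat.sum_antidiagonal_succ']
        have h0 : X ^ (m + 1) * ((1 + X ^ (2 * 0)) * multisumCoeff ℓ (j + 1) 0) -
              X ^ (m + 1) * (multisumCoeff ℓ j 0 + multisumCoeff ℓ (j + 2) 0) = 0 := by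
          simp only [multisumCoeff_zero_right]
          ring
        rw [h0, mul_zero, zero_add]
        refine Finset.sum_congr rfl fun p hp => ?_
        rw [ih (by omega), ← mem_antidiagonal.mp hp]
        ring
      have key : ∑ p ∈ antidiagonal (m + 1), invQPochhammer p.1 *
            ((1 + X ^ (2 * (m + 1))) * multisumCoeff ℓ (j + 1) p.2 -
              X ^ (m + 1) * (multisumCoeff ℓ j p.2 + multisumCoeff ℓ (j + 2) p.2)) =
          ∑ p ∈ antidiagonal (m + 1),
            (1 - X ^ p.1) * invQPochhammer p.1 * multisumCoeff ℓ (j + 1) p.2 := by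
        rw [← sub_eq_zero] at low ⊢
        rw [← low, ← Finset.sum_sub_distrib, ← Finset.sum_sub_distrib]
        refine Finset.sum_congr rfl fun p hp => ?_
        rw [← mem_antidiagonal.mp hp]
        ring
      rw [← key]
      simp only [mul_sub, mul_add, Finset.sum_sub_distrib, Finset.sum_add_distrib, Finset.mul_sum]
      simp only [← Finset.sum_add_distrib, ← Finset.sum_sub_distrib]
      refine Finset.sum_congr rfl fun p _ => ?_
      ring

/-! ### The multisum and its recursive coefficients -/

theorem tailSum_cons_zero {ℓ : ℕ} (a : ℕ) (n : Fin ℓ → ℕ) :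
    tailSum (Fin.cons a n : Fin (ℓ + 1) → ℕ) 0 = a + ∑ s, n s := by
  have : Finset.Ici (0 : Fin (ℓ + 1)) = Finset.univ := by ext; simp
  rw [tailSum, this, Fin.sum_univ_succ]
  simp only [Fin.cons_zero, Fin.cons_succ]

theorem tailSum_cons_succ {ℓ : ℕ} (a : ℕ) (n : Fin ℓ → ℕ) (s : Fin ℓ) :
    tailSum (Fin.cons a n : Fin (ℓ + 1) → ℕ) s.succ = tailSum n s := by
  have : Finset.Ici s.succ = (Finset.Ici s).map (Fin.succEmb ℓ) := by
    ext t
    refine Fin.cases ?_ (fun t => ?_) t <;> simp [Fin.succ_le_succ_iff]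
  simp only [tailSum, this, Finset.sum_map, Fin.coe_succEmb, Fin.cons_succ]

theorem qExponent_eq {ℓ : ℕ} (i : Fin (ℓ + 1)) (n : Fin ℓ → ℕ) :
    qExponent i n = ∑ s : Fin ℓ, (tailSum n s ^ 2 + if (i : ℕ) ≤ s then tailSum n s else 0) := by
  simp [qExponent, Finset.sum_filter, Finset.sum_add_distrib]

theorem sum_antidiagonalTuple_eq_multisumCoeff (ℓ i m : ℕ) :
    ∑ n ∈ Finset.Nat.antidiagonalTuple ℓ m,
      (X ^ (∑ s : Fin ℓ, (tailSum n s ^ 2 + if i ≤ s then tailSum n s else 0)) *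
        ∏ s, invQPochhammer (n s) : ℤ⟦X⟧) = multisumCoeff ℓ i m := by
  induction ℓ generalizing i m with
  | zero => cases m <;> simp [multisumCoeff]
  | succ ℓ ih =>
    rw [multisumCoeff, Finset.mul_sum]
    simp only [← ih, Finset.mul_sum]
    rw [Finset.sum_sigma']
    symm
    refine Finset.sum_bij (fun x _ => Fin.cons x.1.1 x.2) ?_ ?_ ?_ ?_
    · rintro ⟨⟨a, b⟩, n⟩ h
      simp only [Finset.mem_sigma, mem_antidiagonal,
        Finset.Nat.mem_antidiagonalTuple] at h ⊢
      rw [Fin.sum_univ_succ]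
      simp [h.2, h.1]
    · rintro ⟨⟨a, b⟩, n⟩ h ⟨⟨a', b'⟩, n'⟩ h' e
      simp only [Finset.mem_sigma, mem_antidiagonal,
        Finset.Nat.mem_antidiagonalTuple] at h h'
      obtain ⟨rfl, rfl⟩ := Fin.cons_injective2 e
      obtain rfl : b = b' := h.2.symm.trans h'.2
      rfl
    · intro n hn
      rw [Finset.Nat.mem_antidiagonalTuple, Fin.sum_univ_succ] at hn
      exact ⟨⟨(n 0, ∑ s, Fin.tail n s), Fin.tail n⟩,
        by simpa [Finset.Nat.mem_antidiagonalTuple, Fin.tail] using hn, Fin.cons_self_tail n⟩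
    · rintro ⟨⟨a, b⟩, n⟩ h
      simp only [Finset.mem_sigma, mem_antidiagonal,
        Finset.Nat.mem_antidiagonalTuple] at h
      simp only [Fin.sum_univ_succ, Fin.prod_univ_succ, tailSum_cons_zero, tailSum_cons_succ,
        Fin.cons_zero, Fin.cons_succ, h.2, h.1, Fin.val_zero, Fin.val_succ, Nat.le_zero,
        pow_add, tsub_le_iff_right]
      ring

theorem hasSum_multisumTerm {ℓ : ℕ} (i : Fin (ℓ + 1)) :
    HasSum (fun n : Fin ℓ → ℕ => multisumTerm i n)
      (PowerSeries.mk fun m => multisumCoeff ℓ i m) := by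
  rw [PowerSeries.WithPiTopology.hasSum_iff_hasSum_coeff]
  intro m
  rw [coeff_mk, ← sum_antidiagonalTuple_eq_multisumCoeff]
  have h : ∀ n : Fin ℓ → ℕ, coeff m (multisumTerm i n) =
      if ∑ s, n s = m then X ^ qExponent i n * ∏ s, invQPochhammer (n s) else 0 := by
    intro n
    rw [multisumTerm, mul_comm, coeff_C_mul, coeff_X_pow]
    simp [eq_comm]
  simp only [h]
  rw [Finset.sum_congr rfl (g := fun n : Fin ℓ → ℕ =>
    if ∑ s, n s = m then (X ^ qExponent i n * ∏ s, invQPochhammer (n s) : ℤ⟦X⟧) else 0)]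
  · exact hasSum_sum_of_ne_finset_zero fun n hn =>
      if_neg fun h => hn (Finset.Nat.mem_antidiagonalTuple.mpr h)
  · intro n hn
    rw [if_pos (Finset.Nat.mem_antidiagonalTuple.mp hn), qExponent_eq]

/-! ### Separated sets of cells in a cone -/

/-- The cell `d` lies strictly to the right of the light cone of `c`: the positions of `c` and `d`
differ by more than their rows, with `d` to the right.  No downward path
meets both of two distinct cells exactly if one of them follows the other. -/
def Follows (c d : ℕ × ℕ) : Prop := c.2 + d.1 < d.2 + c.1 ∧ c.2 + c.1 < d.2 + d.1

/-- The cell `c` of an array with `R` rows lies to the right of the light cone of the cell in row `r`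
at position `h - 1`, and it has the same parity of row plus position.  The shift by one
makes position `-1` available, where most of the initial conditions stand; the rows `r = 0` and
`r = R + 1` are allowed for the apex.  By parity, the strict inequality between positions and rows
sharpens to a gap of at least two. -/
def InCone (R r h : ℕ) (c : ℕ × ℕ) : Prop :=
  1 ≤ c.1 ∧ c.1 ≤ R ∧ (c.1 + c.2 + r + h) % 2 = 1 ∧
    c.1 + h + 1 ≤ c.2 + r ∧ r + h + 1 ≤ c.2 + c.1

/-- The sets of `m` cells with sum of positions `n` in the cone with apex `(r, h - 1)` that are
pairwise separated. -/
def configs (R r h m n : ℕ) : Set (Finset (ℕ × ℕ)) :=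
  {A | (∀ c ∈ A, InCone R r h c) ∧ (∀ c ∈ A, ∀ d ∈ A, c ≠ d → Follows c d ∨ Follows d c) ∧
    A.card = m ∧ ∑ c ∈ A, c.2 = n}

theorem configs_finite (R r h m n : ℕ) : (configs R r h m n).Finite := by
  refine (Finset.range (R + 1) ×ˢ Finset.range (n + 1)).powerset.finite_toSet.subset ?_
  rintro A ⟨hA, -, -, hn⟩
  simp only [Finset.mem_coe, Finset.mem_powerset]
  intro c hc
  have h₁ := (hA c hc).2.1
  have h₂ : c.2 ≤ ∑ d ∈ A, d.2 :=
    Finset.single_le_sum (f := fun d : ℕ × ℕ => d.2) (fun _ _ => Nat.zero_le _) hc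
  simp only [Finset.mem_product, Finset.mem_range]
  omega

theorem configs_congr {R r h r' h' : ℕ} (H : ∀ c, InCone R r h c ↔ InCone R r' h' c) (m n : ℕ) :
    configs R r h m n = configs R r' h' m n := by
  simp only [configs, H]

/-- An apex just outside the array may be replaced by its neighbor inside. -/
theorem configs_row_zero (R h m n : ℕ) : configs R 0 h m n = configs R 1 (h + 1) m n :=
  configs_congr (fun c => by unfold InCone; omega) m n

theorem configs_row_succ (R h m n : ℕ) :
    configs R (R + 1) h m n = configs R R (h + 1) m n :=
  configs_congr (fun c => by unfold InCone; omega) m n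

theorem lt_of_mem_configs {R r h m n : ℕ} {A : Finset (ℕ × ℕ)}
    (hA : A ∈ configs R r h (m + 1) n) : h < n := by
  obtain ⟨h₁, -, h₃, h₄⟩ := hA
  obtain ⟨c, hc⟩ := Finset.card_pos.mp (h₃.symm ▸ Nat.succ_pos m : 0 < A.card)
  have h₂ : c.2 ≤ ∑ d ∈ A, d.2 :=
    Finset.single_le_sum (f := fun d : ℕ × ℕ => d.2) (fun _ _ => Nat.zero_le _) hc
  have := h₁ c hc
  unfold InCone at this
  omega

theorem configs_zero (R r h n : ℕ) : configs R r h 0 n = if n = 0 then {∅} else ∅ := by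
  ext A
  simp only [configs, Set.mem_ofPred_eq, Finset.card_eq_zero]
  split_ifs with hn
  · constructor
    · rintro ⟨-, -, h, -⟩
      simpa using h
    · rintro rfl
      simp [hn]
  · simp only [Set.mem_empty_iff_false, iff_false]
    rintro ⟨-, -, rfl, h⟩
    exact hn (by simpa using h.symm)

section

variable {R r : ℕ}

/-- The cone of `(r, h - 1)` without its tip `(r, h + 1)` is the union of the cones of the two
neighbors `(r ± 1, h)`, and a separated set cannot meet both differences of these two cones. -/
theorem configs_avoiding_tip (hr : 1 ≤ r) (h m n : ℕ) :
    {A ∈ configs R r h m n | (r, h + 1) ∉ A} =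
      configs R (r + 1) (h + 1) m n ∪ configs R (r - 1) (h + 1) m n := by
  ext A
  simp only [configs, Set.mem_ofPred_eq, Set.mem_union]
  constructor
  · rintro ⟨⟨h₁, h₂, h₃⟩, h₄⟩
    have hside : ∀ c ∈ A, ¬ InCone R (r + 1) (h + 1) c → InCone R (r - 1) (h + 1) c := by
      intro c hc
      have hne : c.1 ≠ r ∨ c.2 ≠ h + 1 := by
        by_contra! hcon
        exact h₄ (by rw [← hcon.1, ← hcon.2]; exact hc)
      have := h₁ c hc
      unfold InCone at *
      omega
    by_cases hall : ∀ c ∈ A, InCone R (r + 1) (h + 1) c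
    · exact .inl ⟨hall, h₂, h₃⟩
    · push Not at hall
      obtain ⟨c, hc, hc'⟩ := hall
      refine .inr ⟨fun d hd => ?_, h₂, h₃⟩
      by_contra hd'
      have hcd : c ≠ d := by
        rintro rfl
        exact hd' (hside c hc hc')
      have h₅ := h₂ c hc d hd hcd
      have h₆ := h₁ c hc
      have h₇ := h₁ d hd
      unfold InCone Follows at *
      omega
  · have aux : ∀ s, (s = r + 1 ∨ s = r - 1) → (∀ c ∈ A, InCone R s (h + 1) c) →
        (∀ c ∈ A, InCone R r h c) ∧ (r, h + 1) ∉ A := by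
      intro s hs hA
      refine ⟨fun c hc => ?_, fun hmem => ?_⟩
      · have := hA c hc
        unfold InCone at *
        omega
      · have := hA _ hmem
        unfold InCone at this
        simp only at this
        omega
    rintro (⟨h₁, h₂, h₃⟩ | ⟨h₁, h₂, h₃⟩)
    · exact ⟨⟨(aux _ (.inl rfl) h₁).1, h₂, h₃⟩, (aux _ (.inl rfl) h₁).2⟩
    · exact ⟨⟨(aux _ (.inr rfl) h₁).1, h₂, h₃⟩, (aux _ (.inr rfl) h₁).2⟩

theorem configs_inter (hr : 1 ≤ r) (h m n : ℕ) :
    configs R (r + 1) (h + 1) m n ∩ configs R (r - 1) (h + 1) m n = configs R r (h + 2) m n := by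
  have H : ∀ c, InCone R (r + 1) (h + 1) c ∧ InCone R (r - 1) (h + 1) c ↔
      InCone R r (h + 2) c := by
    intro c
    unfold InCone
    omega
  ext A
  simp only [configs, Set.mem_ofPred_eq, Set.mem_inter_iff, ← H]
  constructor
  · rintro ⟨⟨h₁, h₂⟩, h₃, -⟩
    exact ⟨fun c hc => ⟨h₁ c hc, h₃ c hc⟩, h₂⟩
  · rintro ⟨h₁, h₂⟩
    exact ⟨⟨fun c hc => (h₁ c hc).1, h₂⟩, fun c hc => (h₁ c hc).2, h₂⟩

/-- If the tip is occupied, then all other cells lie in the cone of the tip. -/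
theorem configs_containing_tip (hr : 1 ≤ r) (hR : r ≤ R) (h m n : ℕ) :
    {A ∈ configs R r h (m + 1) (n + (h + 1)) | (r, h + 1) ∈ A} =
      (insert (r, h + 1)) '' configs R r (h + 2) m n := by
  ext A
  simp only [configs, Set.mem_ofPred_eq, Set.mem_image]
  constructor
  · rintro ⟨⟨h₁, h₂, h₃, h₄⟩, h₅⟩
    refine ⟨A.erase (r, h + 1), ⟨fun c hc => ?_, fun c hc d hd => ?_, ?_, ?_⟩,
      Finset.insert_erase h₅⟩
    · rw [Finset.mem_erase] at hc
      have h₆ := h₂ c hc.2 _ h₅ hc.1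
      have h₇ := h₁ c hc.2
      unfold InCone Follows at *
      simp only at h₆
      omega
    · exact h₂ c (Finset.mem_of_mem_erase hc) d (Finset.mem_of_mem_erase hd)
    · rw [Finset.card_erase_of_mem h₅, h₃, Nat.add_sub_cancel]
    · have := Finset.add_sum_erase A (fun c : ℕ × ℕ => c.2) h₅
      simp only at this
      omega
  · rintro ⟨B, ⟨h₁, h₂, h₃, h₄⟩, rfl⟩
    have hn : (r, h + 1) ∉ B := by
      intro hB
      have := h₁ _ hB
      unfold InCone at this
      simp only at this
      omega
    have htip : ∀ c ∈ B, Follows (r, h + 1) c := by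
      intro c hc
      have := h₁ c hc
      unfold InCone Follows at *
      simp only
      omega
    refine ⟨⟨fun c hc => ?_, fun c hc d hd hcd => ?_, ?_, ?_⟩, Finset.mem_insert_self _ _⟩
    · rcases Finset.mem_insert.mp hc with rfl | hc
      · unfold InCone
        simp only
        omega
      · have := h₁ c hc
        unfold InCone at *
        omega
    · rcases Finset.mem_insert.mp hc with rfl | hc <;> rcases Finset.mem_insert.mp hd with rfl | hd
      · exact absurd rfl hcd
      · exact .inl (htip d hd)
      · exact .inr (htip c hc)
      · exact h₂ c hc d hd hcd
    · rw [Finset.card_insert_of_notMem hn, h₃]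
    · rw [Finset.sum_insert hn, h₄, add_comm]

theorem ncard_configs_containing_tip (hr : 1 ≤ r) (hR : r ≤ R) (h m n : ℕ) :
    {A ∈ configs R r h (m + 1) (n + (h + 1)) | (r, h + 1) ∈ A}.ncard =
      (configs R r (h + 2) m n).ncard := by
  rw [configs_containing_tip hr hR]
  refine Set.InjOn.ncard_image ?_
  have hn : ∀ B ∈ configs R r (h + 2) m n, (r, h + 1) ∉ B := by
    intro B hB hmem
    have := hB.1 _ hmem
    unfold InCone at this
    simp only at this
    omega
  intro B hB B' hB' e
  rw [← Finset.erase_insert (hn B hB), ← Finset.erase_insert (hn B' hB'), e]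

/-- The generating function in `q` of the separated sets of `m` cells in the cone with apex
`(r, h - 1)`. -/
noncomputable def configSeries (R r h m : ℕ) : ℤ⟦X⟧ :=
  PowerSeries.mk fun n => ((configs R r h m n).ncard : ℤ)

/-- Inclusion-exclusion for the cones of the two neighbors of the apex, plus the separated sets that
contain the tip. -/
theorem configSeries_recurrence (hr : 1 ≤ r) (hR : r ≤ R) (h m : ℕ) :
    configSeries R r h (m + 1) + configSeries R r (h + 2) (m + 1) =
      configSeries R (r + 1) (h + 1) (m + 1) + configSeries R (r - 1) (h + 1) (m + 1) +
        X ^ (h + 1) * configSeries R r (h + 2) m := by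
  ext n
  simp only [map_add, coeff_X_pow_mul', configSeries, coeff_mk]
  have hfin := configs_finite R r h (m + 1) n
  have hsplit : (configs R r h (m + 1) n).ncard =
      {A ∈ configs R r h (m + 1) n | (r, h + 1) ∈ A}.ncard +
        {A ∈ configs R r h (m + 1) n | (r, h + 1) ∉ A}.ncard := by
    rw [← Set.ncard_union_eq _ (hfin.subset (Set.sep_subset _ _))
      (hfin.subset (Set.sep_subset _ _))]
    · congr 1
      ext A
      simp only [Set.mem_union, Set.mem_ofPred_eq]
      tauto
    · rw [Set.disjoint_left]
      exact fun A hA hA' => hA'.2 hA.2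
  have hunion := Set.ncard_union_add_ncard_inter (configs R (r + 1) (h + 1) (m + 1) n)
    (configs R (r - 1) (h + 1) (m + 1) n) (configs_finite _ _ _ _ _) (configs_finite _ _ _ _ _)
  rw [← configs_avoiding_tip hr, configs_inter hr] at hunion
  have htip : {A ∈ configs R r h (m + 1) n | (r, h + 1) ∈ A}.ncard =
      if h + 1 ≤ n then (configs R r (h + 2) m (n - (h + 1))).ncard else 0 := by
    split_ifs with hn
    · rw [← ncard_configs_containing_tip hr hR, Nat.sub_add_cancel hn]
    · rw [Set.ncard_eq_zero (hfin.subset (Set.sep_subset _ _))]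
      ext A
      simp only [Set.mem_ofPred_eq, Set.mem_empty_iff_false, iff_false]
      rintro ⟨hA, -⟩
      exact hn (lt_of_mem_configs hA)
  rw [htip] at hsplit
  rw [← Nat.cast_inj (R := ℤ)] at hsplit hunion
  push_cast at hsplit hunion
  rw [hsplit]
  split_ifs <;> linarith

/-- The recurrence determines the generating functions: after multiplication by `q ^ (m * h)`, the
coefficients of the multisum satisfy the same relations.  For fixed `m` and `n`, the difference
`E r h` of the two sides has vanishing coefficient of `q ^ n` as soon as `h > n`, and the
relations carry this down to all `h`. -/
theorem configSeries_eq {ℓ : ℕ} (hℓ : 1 ≤ ℓ) (r h m : ℕ) (hr : r ≤ 2 * ℓ + 1) :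
    configSeries (2 * ℓ) r h m = X ^ (m * h) * multisumCoeff ℓ (min r (2 * ℓ + 1 - r)) m := by
  induction m generalizing r h with
  | zero =>
    ext n
    rw [multisumCoeff_zero_right, configSeries, coeff_mk, configs_zero, zero_mul, pow_zero,
      one_mul, coeff_one]
    split_ifs <;> simp
  | succ m ih =>
    set E : ℕ → ℕ → ℤ⟦X⟧ := fun r h => configSeries (2 * ℓ) r h (m + 1) -
      X ^ ((m + 1) * h) * multisumCoeff ℓ (min r (2 * ℓ + 1 - r)) (m + 1) with hE
    have hrec : ∀ r h, 1 ≤ r → r ≤ 2 * ℓ →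
        E r h + E r (h + 2) = E (r + 1) (h + 1) + E (r - 1) (h + 1) := by
      intro r h h₁ h₂
      have e₁ := configSeries_recurrence h₁ h₂ h m
      rw [ih r (h + 2) (by omega)] at e₁
      -- The relation of the multisums at index `i + 1`, which rows `i + 1` and `2ℓ - i` share.
      have e₂ : (1 + X ^ (2 * (m + 1))) * multisumCoeff ℓ (min r (2 * ℓ + 1 - r)) (m + 1) =
          X ^ (m + 1) * (multisumCoeff ℓ (min (r + 1) (2 * ℓ + 1 - (r + 1))) (m + 1) +
            multisumCoeff ℓ (min (r - 1) (2 * ℓ + 1 - (r - 1))) (m + 1)) +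
          X ^ (2 * m + 1) * multisumCoeff ℓ (min r (2 * ℓ + 1 - r)) m := by
        obtain ⟨i, hi, hi'⟩ : ∃ i, i < ℓ ∧ (r = i + 1 ∨ r = 2 * ℓ - i) := by
          rcases le_total r ℓ with hle | hle
          · exact ⟨r - 1, by omega, by omega⟩
          · rcases hle.eq_or_lt with rfl | hlt
            · exact ⟨ℓ - 1, by omega, by omega⟩
            · exact ⟨2 * ℓ - r, by omega, by omega⟩
        have e₃ := multisumCoeff_recurrence hi m
        -- In the two middle rows, one neighbor has index `ℓ` again instead of `ℓ + 1`.
        have e₄ : multisumCoeff ℓ (min (i + 2) (2 * ℓ - 1 - i)) (m + 1) =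
            multisumCoeff ℓ (i + 2) (m + 1) := by
          rcases (show i + 1 < ℓ ∨ ℓ = i + 1 by omega) with hlt | rfl
          · rw [min_eq_left (by omega)]
          · rw [min_eq_right (by omega), show 2 * (i + 1) - 1 - i = i + 1 by omega,
              multisumCoeff_index_self]
        rw [← e₄] at e₃
        rcases hi' with rfl | rfl
        · rw [show min (i + 1) (2 * ℓ + 1 - (i + 1)) = i + 1 by omega,
            show min (i + 1 + 1) (2 * ℓ + 1 - (i + 1 + 1)) = min (i + 2) (2 * ℓ - 1 - i) by omega,
            show min (i + 1 - 1) (2 * ℓ + 1 - (i + 1 - 1)) = i by omega, e₃]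
          ring
        · rw [show min (2 * ℓ - i) (2 * ℓ + 1 - (2 * ℓ - i)) = i + 1 by omega,
            show min (2 * ℓ - i + 1) (2 * ℓ + 1 - (2 * ℓ - i + 1)) = i by omega,
            show min (2 * ℓ - i - 1) (2 * ℓ + 1 - (2 * ℓ - i - 1)) =
              min (i + 2) (2 * ℓ - 1 - i) by omega, e₃]
      simp only [hE]
      linear_combination e₁ - X ^ ((m + 1) * h) * e₂
    have hzero : ∀ h, E 0 h = E 1 (h + 1) := by
      intro h
      simp only [hE, configSeries, configs_row_zero]
      rw [show min 0 (2 * ℓ + 1 - 0) = 0 by omega, show min 1 (2 * ℓ + 1 - 1) = 1 by omega,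
        multisumCoeff_zero_index]
      ring
    have hlast : ∀ h, E (2 * ℓ + 1) h = E (2 * ℓ) (h + 1) := by
      intro h
      simp only [hE, configSeries, configs_row_succ]
      rw [show min (2 * ℓ + 1) (2 * ℓ + 1 - (2 * ℓ + 1)) = 0 by omega,
        show min (2 * ℓ) (2 * ℓ + 1 - 2 * ℓ) = 1 by omega, multisumCoeff_zero_index]
      ring
    have hcoeff : ∀ n d r h, r ≤ 2 * ℓ + 1 → n < h + d → coeff n (E r h) = 0 := by
      intro n d
      induction d using Nat.strong_induction_on with
      | _ d ihd =>
        intro r h hr hn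
        rcases Nat.eq_zero_or_pos d with rfl | hd
        -- Here `n < h`: the sets have a cell, and all their positions exceed `h`.
        · have h₁ : configs (2 * ℓ) r h (m + 1) n = ∅ := by
            ext A
            simp only [Set.mem_empty_iff_false, iff_false]
            exact fun hA => absurd (lt_of_mem_configs hA) (by omega)
          have h₂ : ¬ (m + 1) * h ≤ n := by nlinarith
          simp [hE, configSeries, h₁, coeff_X_pow_mul', h₂]
        · have step : ∀ s, s ≤ 2 * ℓ + 1 → coeff n (E s (h + 1)) = 0 := fun s hs =>
            ihd (d - 1) (by omega) s (h + 1) hs (by omega)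
          rcases Nat.eq_zero_or_pos r with rfl | hr₁
          · rw [hzero, step 1 (by omega)]
          rcases hr.eq_or_lt with rfl | hr₂
          · rw [hlast, step _ (by omega)]
          have e := congrArg (coeff n) (hrec r h hr₁ (by omega))
          rw [map_add, map_add, step _ (by omega), step _ (by omega),
            ihd (d - 1) (by omega) r (h + 2) hr (by omega)] at e
          simpa using e
    refine sub_eq_zero.mp (PowerSeries.ext fun n => ?_)
    rw [map_zero]
    exact hcoeff n (n + 1) r h hr (by omega)

end

/-! ### Admissible partitions as separated sets -/

theorem max_eq_add_one_or_sub_one {a b a' b' : ℤ} (hab : a % 2 = b % 2)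
    (ha : a' = a + 1 ∨ a' = a - 1) (hb : b' = b + 1 ∨ b' = b - 1) :
    max a' b' = max a b + 1 ∨ max a' b' = max a b - 1 := by
  omega

theorem sub_abs_emod_two {x : ℤ} {r : ℕ} (hxr : x ≡ r [ZMOD 2]) (t : ℤ) :
    (x - |t - r|) % 2 = t % 2 := by
  unfold Int.ModEq at hxr
  rcases abs_cases (t - r) with h | h <;> omega

theorem sub_abs_eq_add_one_or_sub_one (x t r : ℤ) :
    x - |t + 1 - r| = x - |t - r| + 1 ∨ x - |t + 1 - r| = x - |t - r| - 1 := by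
  rcases abs_cases (t - r) with h | h <;> rcases abs_cases (t + 1 - r) with h' | h' <;> omega

/-- Two cells that lie within the light cones of one another are joined by a downward path.  The
path is the upper envelope of the two wedges hanging from the cells and of the zigzag along the
left border of the array; all three have the parity of the row number, so that their maximum
still moves by exactly one in each step. -/
theorem exists_isDownwardPath_through (ℓ : ℕ) {r r' : ℕ} {x x' : ℤ}
    (hx : -1 ≤ x) (hxr : x ≡ r [ZMOD 2]) (hx' : -1 ≤ x') (hxr' : x' ≡ r' [ZMOD 2])
    (hle : |x - x'| ≤ |(r : ℤ) - r'|) :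
    ∃ p, IsDownwardPath ℓ p ∧ p r = x ∧ p r' = x' := by
  have hle' := abs_le.mp hle
  have hmod : ∀ t : ℤ, max (x - |t - r|) (x' - |t - r'|) % 2 = t % 2 := by
    intro t
    rcases max_choice (x - |t - r|) (x' - |t - r'|) with h | h <;> rw [h]
    · exact sub_abs_emod_two hxr t
    · exact sub_abs_emod_two hxr' t
  refine ⟨fun t => max (max (x - |(t : ℤ) - r|) (x' - |(t : ℤ) - r'|)) (-((t : ℤ) % 2)),
    ⟨fun t _ _ => ⟨?_, ?_⟩, fun t _ _ => ?_⟩, ?_, ?_⟩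
  · exact le_trans (by omega) (le_max_right _ _)
  · have := hmod t
    unfold Int.ModEq
    omega
  · push_cast
    refine max_eq_add_one_or_sub_one (by rw [hmod]; omega)
      (max_eq_add_one_or_sub_one ?_ (sub_abs_eq_add_one_or_sub_one _ _ _)
        (sub_abs_eq_add_one_or_sub_one _ _ _)) (by omega)
    rw [sub_abs_emod_two hxr, sub_abs_emod_two hxr']
  · unfold Int.ModEq at hxr
    simp only [sub_self, abs_zero, sub_zero]
    rw [max_eq_left (by omega : x' - |(r : ℤ) - r'| ≤ x), max_eq_left (by omega)]
  · unfold Int.ModEq at hxr'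
    simp only [sub_self, abs_zero, sub_zero]
    rw [abs_sub_comm, max_eq_right (by omega : x - |(r : ℤ) - r'| ≤ x'), max_eq_left (by omega)]

theorem IsDownwardPath.abs_sub_le {ℓ : ℕ} {p : ℕ → ℤ} (hp : IsDownwardPath ℓ p) {r d : ℕ}
    (hr : 1 ≤ r) (hd : r + d ≤ 2 * ℓ) : |p (r + d) - p r| ≤ d := by
  induction d with
  | zero => simp
  | succ d ih =>
    have h₁ := abs_le.mp (ih (by omega))
    have h₂ := hp.step (r + d) (by omega) (by omega)
    rw [abs_le, ← add_assoc]
    push_cast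
    omega

theorem initialEntry_unitInitial (ℓ : ℕ) (i : Fin (ℓ + 1)) (r : ℕ) (x : ℤ) :
    initialEntry ℓ (unitInitial ℓ i) r x =
      if r = initialRow ℓ i ∧ x = initialPos i then 1 else 0 := by
  rw [initialEntry, Finset.sum_eq_single i]
  · simp [unitInitial]
  · intro j _ hj
    simp [unitInitial, hj]
  · simp

theorem sum_unitInitial (ℓ : ℕ) (i : Fin (ℓ + 1)) : ∑ j, unitInitial ℓ i j = 1 := by
  simp [unitInitial]

theorem initialRow_initialPos_spec {ℓ i : ℕ} (hℓ : 1 ≤ ℓ) (hi : i ≤ ℓ) :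
    1 ≤ initialRow ℓ i ∧ initialRow ℓ i ≤ 2 * ℓ ∧ -1 ≤ initialPos i ∧ initialPos i ≤ 0 ∧
      initialPos i ≡ initialRow ℓ i [ZMOD 2] := by
  unfold initialRow initialPos Int.ModEq
  split_ifs with h₁ h₂
  · omega
  · rw [Nat.odd_iff] at h₂
    omega
  · rw [Nat.odd_iff] at h₂
    omega

/-- The parts to the right of the light cone of the initial cell form one of the cones of `InCone`.  The
initial cell of `k_0` stands in row `2ℓ` at position `0`; it has the same cone as a cell in row
`2ℓ + 1` at position `-1`. -/
theorem inCone_iff_isPart_and {ℓ i : ℕ} (hi : i ≤ ℓ) (c : ℕ × ℕ) :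
    InCone (2 * ℓ) (if i = 0 then 2 * ℓ + 1 else initialRow ℓ i) 0 c ↔
      IsPart ℓ c ∧ |(c.1 : ℤ) - initialRow ℓ i| < c.2 - initialPos i := by
  rw [abs_lt]
  unfold InCone IsPart initialRow initialPos Nat.ModEq
  split_ifs with h₁ h₂
  · push_cast
    omega
  · rw [Nat.odd_iff] at h₂
    omega
  · rw [Nat.odd_iff] at h₂
    omega

theorem follows_or_follows_iff (c d : ℕ × ℕ) :
    Follows c d ∨ Follows d c ↔ |(c.1 : ℤ) - d.1| < |(c.2 : ℤ) - d.2| := by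
  unfold Follows
  rcases abs_cases ((c.1 : ℤ) - d.1) with h | h <;>
    rcases abs_cases ((c.2 : ℤ) - d.2) with h' | h' <;> omega

section

variable {ℓ : ℕ} {i : Fin (ℓ + 1)} {f : ℕ × ℕ →₀ ℕ}

theorem entry_natCast {k : Fin (ℓ + 1) → ℕ} {c : ℕ × ℕ} (hc : IsPart ℓ c) :
    entry ℓ k f c.1 c.2 = f c := by
  have := hc.2.2.1
  rw [entry, if_neg (by omega), Int.toNat_natCast]

theorem entry_initial (hℓ : 1 ≤ ℓ) :
    entry ℓ (unitInitial ℓ i) f (initialRow ℓ i) (initialPos i) = 1 := by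
  rw [entry, if_pos (initialRow_initialPos_spec hℓ (Nat.le_of_lt_succ i.2)).2.2.2.1,
    initialEntry_unitInitial, if_pos ⟨rfl, rfl⟩]

theorem IsAdmissible.entry_add_entry_le (h : IsAdmissible ℓ (unitInitial ℓ i) f)
    {r r' : ℕ} {x x' : ℤ} (hr : 1 ≤ r) (hrℓ : r ≤ 2 * ℓ) (hr' : 1 ≤ r') (hrℓ' : r' ≤ 2 * ℓ)
    (hx : -1 ≤ x) (hxr : x ≡ r [ZMOD 2]) (hx' : -1 ≤ x') (hxr' : x' ≡ r' [ZMOD 2])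
    (hne : r ≠ r') (hle : |x - x'| ≤ |(r : ℤ) - r'|) :
    entry ℓ (unitInitial ℓ i) f r x + entry ℓ (unitInitial ℓ i) f r' x' ≤ 1 := by
  obtain ⟨p, hp, rfl, rfl⟩ := exists_isDownwardPath_through ℓ hx hxr hx' hxr' hle
  have := h p hp
  rw [sum_unitInitial] at this
  refine le_trans ?_ this
  rw [← Finset.sum_pair (f := fun t => entry ℓ (unitInitial ℓ i) f t (p t)) hne]
  refine Finset.sum_le_sum_of_subset fun t ht => ?_
  simp only [Finset.mem_insert, Finset.mem_singleton] at ht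
  rw [Finset.mem_Icc]
  omega

theorem IsPart.position {c : ℕ × ℕ} (hc : IsPart ℓ c) :
    -1 ≤ (c.2 : ℤ) ∧ (c.2 : ℤ) ≡ c.1 [ZMOD 2] := by
  obtain ⟨-, -, -, h⟩ := hc
  unfold Nat.ModEq Int.ModEq at *
  omega

theorem IsAdmissible.apply_le_one (h : IsAdmissible ℓ (unitInitial ℓ i) f)
    (hf : IsColoredPartition ℓ f) (c : ℕ × ℕ) : f c ≤ 1 := by
  by_cases hc : c ∈ f.support
  · have hpart := hf c hc
    obtain ⟨p, hp, hpc, -⟩ := exists_isDownwardPath_through ℓ hpart.position.1 hpart.position.2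
      hpart.position.1 hpart.position.2 (by simp)
    have := h p hp
    rw [sum_unitInitial] at this
    refine le_trans ?_ this
    rw [← entry_natCast (k := unitInitial ℓ i) hpart, ← hpc]
    exact Finset.single_le_sum (f := fun t => entry ℓ (unitInitial ℓ i) f t (p t))
      (fun _ _ => Nat.zero_le _) (Finset.mem_Icc.mpr ⟨hpart.1, hpart.2.1⟩)
  · simp [Finsupp.notMem_support_iff.mp hc]

theorem IsAdmissible.abs_lt_abs (h : IsAdmissible ℓ (unitInitial ℓ i) f)
    (hf : IsColoredPartition ℓ f) {c d : ℕ × ℕ} (hc : c ∈ f.support) (hd : d ∈ f.support)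
    (hne : c ≠ d) : |(c.1 : ℤ) - d.1| < |(c.2 : ℤ) - d.2| := by
  have hc' := hf c hc
  have hd' := hf d hd
  by_cases hrow : c.1 = d.1
  · rw [hrow, sub_self, abs_zero, abs_pos, sub_ne_zero]
    exact fun e => hne (Prod.ext hrow (by exact_mod_cast e))
  · by_contra! hle
    have := h.entry_add_entry_le hc'.1 hc'.2.1 hd'.1 hd'.2.1 hc'.position.1 hc'.position.2
      hd'.position.1 hd'.position.2 hrow hle
    rw [entry_natCast hc', entry_natCast hd'] at this
    rw [Finsupp.mem_support_iff] at hc hd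
    omega

theorem IsAdmissible.abs_lt_sub_initialPos (hℓ : 1 ≤ ℓ)
    (h : IsAdmissible ℓ (unitInitial ℓ i) f)
    (hf : IsColoredPartition ℓ f) {c : ℕ × ℕ} (hc : c ∈ f.support) :
    |(c.1 : ℤ) - initialRow ℓ i| < c.2 - initialPos i := by
  have hc' := hf c hc
  obtain ⟨h₁, h₂, h₃, h₄, h₅⟩ := initialRow_initialPos_spec hℓ (Nat.le_of_lt_succ i.2)
  have hpos := hc'.2.2.1
  by_cases hrow : c.1 = initialRow ℓ i
  · rw [hrow, sub_self, abs_zero]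
    omega
  · by_contra! hle
    rw [← abs_of_pos (show (0 : ℤ) < c.2 - initialPos i by omega)] at hle
    have := h.entry_add_entry_le hc'.1 hc'.2.1 h₁ h₂ hc'.position.1 hc'.position.2
      h₃ h₅ hrow hle
    rw [entry_natCast hc', entry_initial hℓ] at this
    rw [Finsupp.mem_support_iff] at hc
    omega

/-- A nonzero entry of the extended frequency array stands either in the initial cell or in a cell of
the support. -/
theorem entry_eq_zero_or (f : ℕ × ℕ →₀ ℕ) (hf : ∀ c, f c ≤ 1) (r : ℕ) (x : ℤ) :
    entry ℓ (unitInitial ℓ i) f r x = 0 ∨ (entry ℓ (unitInitial ℓ i) f r x = 1 ∧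
      ((r = initialRow ℓ i ∧ x = initialPos i) ∨ 0 < x ∧ (r, x.toNat) ∈ f.support)) := by
  rw [entry]
  split_ifs with hx
  · rw [initialEntry_unitInitial]
    split_ifs with h
    · exact .inr ⟨rfl, .inl h⟩
    · exact .inl rfl
  · have := hf (r, x.toNat)
    rcases (show f (r, x.toNat) = 0 ∨ f (r, x.toNat) = 1 by omega) with h | h
    · exact .inl h
    · exact .inr ⟨h, .inr ⟨by omega, by simp [h]⟩⟩

/-- A path changes its position by at most one in each row, so it meets at most one cell of a
separated set that includes the initial cell. -/
theorem isAdmissible_of_separated (h₁ : ∀ c, f c ≤ 1)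
    (h₂ : ∀ c ∈ f.support, ∀ d ∈ f.support, c ≠ d → |(c.1 : ℤ) - d.1| < |(c.2 : ℤ) - d.2|)
    (h₃ : ∀ c ∈ f.support, |(c.1 : ℤ) - initialRow ℓ i| < c.2 - initialPos i) :
    IsAdmissible ℓ (unitInitial ℓ i) f := by
  intro p hp
  rw [sum_unitInitial]
  have key : ∀ r, 1 ≤ r → ∀ d, r + (d + 1) ≤ 2 * ℓ →
      entry ℓ (unitInitial ℓ i) f r (p r) = 0 ∨
        entry ℓ (unitInitial ℓ i) f (r + (d + 1)) (p (r + (d + 1))) = 0 := by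
    intro r hr d hd
    have hlip := abs_le.mp (hp.abs_sub_le hr hd)
    rcases entry_eq_zero_or (ℓ := ℓ) (i := i) f h₁ r (p r) with h | ⟨-, h⟩
    · exact .inl h
    rcases entry_eq_zero_or (ℓ := ℓ) (i := i) f h₁ (r + (d + 1)) (p (r + (d + 1)))
      with h' | ⟨-, h'⟩
    · exact .inr h'
    exfalso
    push_cast at hlip
    rcases h with ⟨e₁, e₂⟩ | ⟨hpos, hmem⟩ <;> rcases h' with ⟨e₁', e₂'⟩ | ⟨hpos', hmem'⟩
    · omega
    · have := abs_lt.mp (h₃ _ hmem')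
      push_cast at this
      rw [Int.toNat_of_nonneg hpos'.le, ← e₁, ← e₂] at this
      omega
    · have := abs_lt.mp (h₃ _ hmem)
      push_cast at this
      rw [Int.toNat_of_nonneg hpos.le, ← e₁', ← e₂'] at this
      push_cast at this
      omega
    · have := h₂ _ hmem _ hmem' (by simp)
      push_cast at this
      rw [Int.toNat_of_nonneg hpos.le, Int.toNat_of_nonneg hpos'.le, lt_abs] at this
      have := neg_abs_le ((r : ℤ) - (r + (d + 1)))
      omega
  by_cases hall : ∀ r ∈ Finset.Icc 1 (2 * ℓ), entry ℓ (unitInitial ℓ i) f r (p r) = 0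
  · rw [Finset.sum_eq_zero hall]
    exact zero_le_one
  · push Not at hall
    obtain ⟨r, hr, hne⟩ := hall
    rw [Finset.mem_Icc] at hr
    rw [Finset.sum_eq_single r]
    · have := entry_eq_zero_or (ℓ := ℓ) (i := i) f h₁ r (p r)
      omega
    · intro t ht htr
      rw [Finset.mem_Icc] at ht
      rcases lt_or_gt_of_ne htr with hlt | hlt
      · have := key t ht.1 (r - t - 1) (by omega)
        rw [show t + (r - t - 1 + 1) = r by omega] at this
        exact this.resolve_right hne
      · have := key r hr.1 (t - r - 1) (by omega)
        rw [show r + (t - r - 1 + 1) = t by omega] at this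
        exact this.resolve_left hne
    · exact fun h => absurd (Finset.mem_Icc.mpr hr) h

/-- The colored partition in which each cell of `A` occurs once. -/
noncomputable def indicatorPartition (A : Finset (ℕ × ℕ)) : ℕ × ℕ →₀ ℕ :=
  Finsupp.indicator A fun _ _ => 1

theorem support_indicatorPartition (A : Finset (ℕ × ℕ)) : (indicatorPartition A).support = A := by
  ext c
  simp [indicatorPartition, Finsupp.indicator_apply]

theorem indicatorPartition_support (hf : ∀ c, f c ≤ 1) : indicatorPartition f.support = f := by
  ext c
  have := hf c
  simp only [indicatorPartition, Finsupp.indicator_apply, Finsupp.mem_support_iff]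
  split_ifs with h <;> omega

theorem indicatorPartition_le_one (A : Finset (ℕ × ℕ)) (c : ℕ × ℕ) :
    indicatorPartition A c ≤ 1 := by
  simp only [indicatorPartition, Finsupp.indicator_apply]
  split_ifs <;> simp

theorem indicatorPartition_apply {A : Finset (ℕ × ℕ)} {c : ℕ × ℕ} (hc : c ∈ A) :
    indicatorPartition A c = 1 := by
  simp [indicatorPartition, Finsupp.indicator_apply, hc]

theorem numParts_indicatorPartition (A : Finset (ℕ × ℕ)) :
    numParts (indicatorPartition A) = A.card := by
  rw [numParts, Finsupp.sum, support_indicatorPartition, Finset.card_eq_sum_ones]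
  exact Finset.sum_congr rfl fun c hc => indicatorPartition_apply hc

theorem size_indicatorPartition (A : Finset (ℕ × ℕ)) :
    size (indicatorPartition A) = ∑ c ∈ A, c.2 := by
  rw [size, Finsupp.sum, support_indicatorPartition]
  exact Finset.sum_congr rfl fun c hc => by rw [indicatorPartition_apply hc, one_mul]

theorem admissiblePartitions_eq_image (hℓ : 1 ≤ ℓ) (i : Fin (ℓ + 1)) (m n : ℕ) :
    admissiblePartitions ℓ (unitInitial ℓ i) m n = indicatorPartition ''
      configs (2 * ℓ) (if (i : ℕ) = 0 then 2 * ℓ + 1 else initialRow ℓ i) 0 m n := by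
  have hcone := inCone_iff_isPart_and (Nat.le_of_lt_succ i.2)
  ext f
  simp only [configs, Set.mem_image, Set.mem_ofPred_eq, admissiblePartitions, hcone,
    follows_or_follows_iff]
  constructor
  · rintro ⟨hf, hadm, rfl, rfl⟩
    have hind := indicatorPartition_support (hadm.apply_le_one hf)
    refine ⟨f.support, ⟨fun c hc => ⟨hf c hc, hadm.abs_lt_sub_initialPos hℓ hf hc⟩,
      fun c hc d hd => hadm.abs_lt_abs hf hc hd, ?_, ?_⟩, hind⟩
    · rw [← numParts_indicatorPartition, hind]
    · rw [← size_indicatorPartition, hind]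
  · rintro ⟨A, ⟨h₁, h₂, rfl, rfl⟩, rfl⟩
    refine ⟨?_, isAdmissible_of_separated (indicatorPartition_le_one A) ?_ ?_,
      numParts_indicatorPartition A, size_indicatorPartition A⟩
    · intro c hc
      rw [support_indicatorPartition] at hc
      exact (h₁ c hc).1
    · rwa [support_indicatorPartition]
    · rw [support_indicatorPartition]
      exact fun c hc => (h₁ c hc).2

theorem F_eq_coeff_multisumCoeff (hℓ : 1 ≤ ℓ) (i : Fin (ℓ + 1)) (m n : ℕ) :
    (F ℓ i m n : ℤ) = coeff n (multisumCoeff ℓ i m) := by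
  have hinj : Function.Injective indicatorPartition :=
    Function.LeftInverse.injective (g := Finsupp.support) support_indicatorPartition
  rw [F, admissiblePartitions_eq_image hℓ, Set.ncard_image_of_injective _ hinj]
  have hi := Nat.le_of_lt_succ i.2
  have e := configSeries_eq hℓ (if (i : ℕ) = 0 then 2 * ℓ + 1 else initialRow ℓ i) 0 m (by
    have := (initialRow_initialPos_spec hℓ hi).2.1
    split_ifs <;> omega)
  have hmin : min (if (i : ℕ) = 0 then 2 * ℓ + 1 else initialRow ℓ i)
      (2 * ℓ + 1 - (if (i : ℕ) = 0 then 2 * ℓ + 1 else initialRow ℓ i)) = i := by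
    unfold initialRow
    split_ifs <;> omega
  rw [hmin, mul_zero, pow_zero, one_mul] at e
  rw [← e, configSeries, coeff_mk]

end

end CMPP

/-- The multisum converges in `ℤ⟦q⟧⟦z⟧` to `P_i(z, q)`.  The topology is the product topology of
the discrete topologies on the coefficients (formal convergence): each coefficient of the
multisum has only finitely many nonzero contributions, and their sum is that of `P_i`. -/
theorem theorem1p5 (ℓ : ℕ) (hℓ : 2 ≤ ℓ) (i : Fin (ℓ + 1)) :
    HasSum (fun n : Fin ℓ → ℕ => CMPP.multisumTerm i n) (CMPP.P ℓ i) := by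
  convert CMPP.hasSum_multisumTerm i using 1
  ext m n
  simp only [CMPP.P, coeff_mk]
  exact CMPP.F_eq_coeff_multisumCoeff (by omega) i m n
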